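/- For integers $\sigma\ge 1$ and $n,k\ge 0$ let $E_\sigma(n,k)$ be the number of partitions of the set $\{1,\dots,k\}$ into exactly $n$ blocks, each of size between $1$ and $\sigma+1$, and put $E_\sigma(n,k)=0$ if $n<0$ or $k<0$. For $n\ge 0$ let $G_\sigma(n)$ be the number of ways in which the following gift-swapping game can be played out, and put $G_\sigma(n)=0$ for $n<0$. There are $n+1$ guests, called one after another in the order $1,2,\dots,n+1$, and $n+1$ wrapped gifts in a pool. A guest whose turn it is (because this guest has just been called, or has just been robbed) either unwraps and takes a gift from the pool, after which the next guest is called, or steals an unwrapped gift from the guest who holds it, after which it is the turn of the robbed guest. No gift may be stolen more than $\sigma$ times in total, the gifts are taken from the pool in the order $1,2,\dots,n+1$, and the game ends as soon as gift $n+1$ is taken. Then for every $\sigma\ge 1$: (i) There are an integer $\delta\ge 0$ and polynomials $C^{(E)}_{i,j}(n)\in\mathbb{Q}[n]$ $(0\le i,j\le\delta)$, not all zero, such that $$\sum_{i=0}^{\delta}\sum_{j=0}^{\delta} C^{(E)}_{i,j}(n)\,E_\sigma(n-i,k-j)=0\qquad\text{for all integers } n,k.$$ (ii) There are an integer $\delta\ge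 0$ and polynomials $C^{(G)}_{i}(n)\in\mathbb{Q}[n]$ $(0\le i\le\delta)$, not all zero, such that $$\sum_{i=0}^{\delta} C^{(G)}_{i}(n)\,G_\sigma(n-i)=0\qquad\text{for all integers } n.$$ -/

import Mathlib

open Finset Polynomial

namespace GiftSwap

/-- The `h`-restricted Stirling number of the second kind: the number of partitions of a labeled
`k`-element set into exactly `n` (nonempty) blocks, each of size at most `h`. -/
noncomputable def restrictedStirling (h k n : ℕ) : ℕ :=
  Set.ncard {P : Finpartition (Finset.univ : Finset (Fin k)) |
    P.parts.card = n ∧ ∀ b ∈ P.parts, b.card ≤ h}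

/-- `E σ n k` is the number of partitions of `{1, …, k}` into exactly `n` blocks of sizes in the
range `[1, …, σ + 1]`, extended by zero to negative `n` or `k`. -/
noncomputable def E (σ : ℕ) (n k : ℤ) : ℕ :=
  if 0 ≤ n ∧ 0 ≤ k then restrictedStirling (σ + 1) k.toNat n.toNat else 0

/-- A position in the gift-swapping game in which the gifts `1, 2, …` are taken from the pool in
this order. The guests are `1, 2, …`, in the order in which they are called. -/
structure Position where
  /-- the gifts unwrapped so far are `1, …, unwrapped` -/
  unwrapped : ℕ
  /-- the guests called so far are `1, …, called` -/
  called : ℕ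
  /-- the guest whose turn it is; this guest holds no gift -/
  turn : ℕ
  /-- `holder g` is the guest who holds the unwrapped gift `g` -/
  holder : ℕ → ℕ
  /-- `thefts g` is the number of times that the gift `g` has been stolen -/
  thefts : ℕ → ℕ

/-- The first guest has been called and no gift has been unwrapped. -/
def Position.start : Position where
  unwrapped := 0
  called := 1
  turn := 1
  holder := fun _ => 0
  thefts := fun _ => 0

/-- The guest whose turn it is unwraps the next gift from the pool and keeps it; the host then
calls the next guest. -/
def Position.afterUnwrap (p : Position) : Position where
  unwrapped := p.unwrapped + 1
  called := p.called + 1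
  turn := p.called + 1
  holder := Function.update p.holder (p.unwrapped + 1) p.turn
  thefts := p.thefts

/-- The guest whose turn it is steals the gift `g`; it is then the turn of the guest from whom the
gift was stolen. -/
def Position.afterSteal (p : Position) (g : ℕ) : Position where
  unwrapped := p.unwrapped
  called := p.called
  turn := p.holder g
  holder := Function.update p.holder g p.turn
  thefts := Function.update p.thefts g (p.thefts g + 1)

/-- `IsPlay σ m p l` says that, in the game with `m` guests and `m` gifts in which no gift may be
stolen more than `σ` times, `l` is a complete list of the actions by which the game can be played
out from the position `p`. An action `(x, g)` means that guest `x` takes gift `g`, either from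
the pool or from its holder. The game ends as soon as the gift `m` has been taken. -/
def IsPlay (σ m : ℕ) : Position → List (ℕ × ℕ) → Prop
  | p, [] => p.unwrapped = m
  | p, (x, g) :: l => p.unwrapped < m ∧ x = p.turn ∧
      ((g = p.unwrapped + 1 ∧ IsPlay σ m p.afterUnwrap l) ∨
        ((1 ≤ g ∧ g ≤ p.unwrapped) ∧ p.thefts g < σ ∧ IsPlay σ m (p.afterSteal g) l))

/-- For `n ≥ 0`, `G σ n` is the number of scenarios of the gift-swapping game with `n + 1` guests
and `n + 1` gifts and a limit of `σ` steals per gift, where the gifts are taken from the pool in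
the order `1, 2, …, n + 1`. It is extended by zero to negative `n`. -/
noncomputable def G (σ : ℕ) (n : ℤ) : ℕ :=
  if 0 ≤ n then Set.ncard {l : List (ℕ × ℕ) | IsPlay σ (n.toNat + 1) Position.start l} else 0

end GiftSwap

/-!
Let `p = ∑ x ^ i / i!` over `1 ≤ i ≤ σ + 1` (`blockPoly`) and let `borelSum y` be the linear
functional `x ^ k ↦ k! y ^ k`. Both counting problems are values of this functional on powers of
`p`: with `y` an indeterminate, `borelSum y (p ^ n) = n! ∑ k, E σ n k y ^ k`, and with `y = 1`,
`borelSum 1 (p ^ n) = n! G σ n`.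

* For `E` (`factorial_mul_E`), classifying the partitions of a set by the block of one element
  gives the identity `(p ^ (n + 1) / (n + 1)!)' = (p ^ n / n!) p'` coefficientwise.
* For `G` (`factorial_mul_card_plays`), the plays from a position with `b + 1` wrapped gifts and
  with `s g` thefts left for each unwrapped gift `g` have generating function
  `∏ g, expTrunc (s g) * p ^ b / b!`, where the final action is not counted. By the product
  rule its derivative is the sum of the generating functions of the positions that one action can
  lead to.

The recurrences come from the functional alone. Integration by parts
(`mul_borelSum_derivative`), applied to `q p ^ (m + 1)`, gives
`borelSum y (q p p ^ m) = y borelSum y (((q p)' + m q p') p ^ m)`. Here `q p` has degree larger by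
one than the polynomials on the right can have, so every sequence `m ↦ borelSum y (q p ^ m)` is a
combination of those with `q = 1, x, …, x ^ σ`, with coefficients polynomial in `m` and `y`
(`isReducible_borelSum`). The `σ + 2` sequences `borelSum y (p ^ (m + i))`, `i ≤ σ + 1`, are
therefore linearly dependent over the polynomials in `m` and `y`
(`exists_recurrence_borelSum_pow`). Setting `y = 1` at the outset gives the recurrence for `G`;
keeping `y` and comparing coefficients of its powers gives the one for `E`.
-/

namespace GiftSwap

/-! ### A recurrence for the values of a functional on the powers of a polynomial -/

section Recurrence

variable {S : Type*} [CommRing S]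

/-- The `S`-linear functional on `S[X]` that sends `X ^ k` to `k! y ^ k`. -/
noncomputable def borelSum (y : S) : S[X] →ₗ[S] S :=
  Polynomial.lsum fun k => (k.factorial * y ^ k : S) • LinearMap.id

lemma borelSum_apply (y : S) (f : S[X]) :
    borelSum y f = f.sum fun k a => (k.factorial * y ^ k) * a := rfl

lemma borelSum_monomial (y : S) (k : ℕ) (a : S) :
    borelSum y (monomial k a) = k.factorial * y ^ k * a := by
  rw [borelSum_apply, sum_monomial_index _ _ (by simp)]

lemma borelSum_C_mul (y a : S) (f : S[X]) : borelSum y (C a * f) = a * borelSum y f := by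
  rw [← smul_eq_C_mul, map_smul, smul_eq_mul]

/-- Integration by parts for `borelSum`. -/
lemma mul_borelSum_derivative (y : S) (f : S[X]) :
    y * borelSum y (derivative f) = borelSum y f - f.coeff 0 := by
  induction f using Polynomial.induction_on' with
  | add p q hp hq => simp only [map_add, mul_add, hp, hq, coeff_add]; ring
  | monomial k a =>
    rw [derivative_monomial, borelSum_monomial, borelSum_monomial, coeff_monomial]
    rcases k with _ | k
    · simp
    · simp only [Nat.succ_ne_zero, if_false, Nat.add_sub_cancel, Nat.factorial_succ]
      push_cast
      ring

/-- `φ` is a combination, with coefficients polynomial in `m`, of the sequences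
`m ↦ borelSum y (X ^ j * P ^ m)` with `j < h`. -/
def IsReducible (P : S[X]) (y : S) (h : ℕ) (φ : ℕ → S) : Prop :=
  ∃ a : Fin h → S[X], ∀ m : ℕ, φ m = ∑ j, (a j).eval (m : S) * borelSum y (X ^ (j : ℕ) * P ^ m)

lemma IsReducible.add {P : S[X]} {y : S} {h : ℕ} {φ ψ : ℕ → S} (hφ : IsReducible P y h φ)
    (hψ : IsReducible P y h ψ) : IsReducible P y h (fun m => φ m + ψ m) := by
  obtain ⟨a, ha⟩ := hφ
  obtain ⟨b, hb⟩ := hψ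
  refine ⟨fun j => a j + b j, fun m => ?_⟩
  simp only [ha, hb, eval_add, add_mul, Finset.sum_add_distrib]

lemma IsReducible.eval_mul {P : S[X]} {y : S} {h : ℕ} {φ : ℕ → S} (hφ : IsReducible P y h φ)
    (c : S[X]) : IsReducible P y h (fun m => c.eval (m : S) * φ m) := by
  obtain ⟨a, ha⟩ := hφ
  refine ⟨fun j => c * a j, fun m => ?_⟩
  simp only [ha, Polynomial.eval_mul, Finset.mul_sum, mul_assoc]

/-- Integrating the derivative of `q * P ^ (m + 1)` by parts gives a linear relation between the
values of `borelSum y` on multiples of `P ^ m`. -/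
lemma borelSum_by_parts {P : S[X]} (hP0 : P.coeff 0 = 0) (y : S) (q : S[X]) (m : ℕ) :
    borelSum y ((q * P) * P ^ m) =
      y * borelSum y (derivative (q * P) * P ^ m) +
        (m : S) * (y * borelSum y ((q * derivative P) * P ^ m)) := by
  have h := mul_borelSum_derivative y (q * P ^ (m + 1))
  have h0 : (q * P ^ (m + 1)).coeff 0 = 0 := by
    rw [mul_coeff_zero, coeff_zero_eq_eval_zero (P ^ (m + 1)), eval_pow,
      ← coeff_zero_eq_eval_zero, hP0]
    simp
  have h1 : derivative (q * P ^ (m + 1)) =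
      derivative (q * P) * P ^ m + (m : S) • ((q * derivative P) * P ^ m) := by
    rw [derivative_mul, derivative_pow_succ, derivative_mul, smul_eq_C_mul]
    simp only [map_add, map_natCast, map_one]
    ring
  rw [h0, h1, sub_zero, map_add, map_smul, smul_eq_mul] at h
  rw [mul_assoc, ← pow_succ', ← h]
  ring

/-- Since the leading coefficient of `P` is invertible and `P` has no constant term, integration by
parts lowers the degree of `q` for as long as it is at least the degree of `P`. -/
lemma isReducible_borelSum {P : S[X]} {h : ℕ} (hh : 0 < h) (hdeg : P.natDegree ≤ h) {v : S}
    (hv : v * P.coeff h = 1) (hP0 : P.coeff 0 = 0) (y : S) (k : ℕ) :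
    ∀ q : S[X], q.degree < k → IsReducible P y h (fun m => borelSum y (q * P ^ m)) := by
  induction k with
  | zero =>
    intro q hq
    have : q = 0 := by
      rw [← degree_eq_bot]
      exact Nat.WithBot.lt_zero_iff.1 hq
    subst this
    exact ⟨0, fun m => by simp⟩
  | succ k ih =>
    have key : IsReducible P y h (fun m => borelSum y (X ^ k * P ^ m)) := by
      rcases lt_or_ge k h with hk | hk
      · refine ⟨Pi.single ⟨k, hk⟩ 1, fun m => ?_⟩
        rw [Finset.sum_eq_single ⟨k, hk⟩]
        · simp
        · intro b _ hb
          simp [Pi.single_eq_of_ne hb]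
        · simp
      · set q : S[X] := X ^ (k - h) with hq
        have hqd : q.natDegree ≤ k - h := natDegree_X_pow_le _
        have hqP : (q * P).natDegree ≤ k := by
          refine natDegree_mul_le.trans ?_
          omega
        have lt_of : ∀ f : S[X], f.natDegree ≤ k - 1 → f.degree < k := fun f hf =>
          lt_of_le_of_lt degree_le_natDegree (by exact_mod_cast (by omega : f.natDegree < k))
        have d1 : (derivative (q * P)).degree < k :=
          lt_of _ ((natDegree_derivative_le _).trans (by omega))
        have d2 : (q * derivative P).degree < k := by
          refine lt_of _ (natDegree_mul_le.trans ?_)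
          have := natDegree_derivative_le P
          omega
        have hc : (q * P).coeff k = P.coeff h := by
          rw [hq, coeff_X_pow_mul', if_pos (by omega)]
          congr 1
          omega
        have d3 : (q * P - C (P.coeff h) * X ^ k).degree < (k : WithBot ℕ) := by
          rw [degree_lt_iff_coeff_zero]
          intro j hj
          rw [coeff_sub, coeff_C_mul_X_pow]
          rcases eq_or_lt_of_le hj with rfl | hj
          · simp [hc]
          · rw [if_neg (by omega), coeff_eq_zero_of_natDegree_lt (by omega), sub_zero]
        obtain ⟨a, ha⟩ := (((ih _ d1).eval_mul (C y)).add
          (((ih _ d2).eval_mul (X * C y)).add ((ih _ d3).eval_mul (-1)))).eval_mul (C v)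
        refine ⟨a, fun m => ?_⟩
        rw [← ha]
        have e := borelSum_by_parts hP0 y q m
        have e2 : borelSum y (q * P * P ^ m) = P.coeff h * borelSum y (X ^ k * P ^ m) +
            borelSum y ((q * P - C (P.coeff h) * X ^ k) * P ^ m) := by
          rw [← borelSum_C_mul, ← map_add]
          congr 1
          ring
        simp only [eval_C, Polynomial.eval_mul, eval_X, eval_neg, eval_one]
        linear_combination v * e - v * e2 - (borelSum y (X ^ k * P ^ m)) * hv
    intro q hq
    have hq' : (q - C (q.coeff k) * X ^ k).degree < (k : WithBot ℕ) := by
      rw [degree_lt_iff_coeff_zero] at hq ⊢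
      intro j hj
      rw [coeff_sub, coeff_C_mul_X_pow]
      rcases eq_or_lt_of_le hj with rfl | hj
      · simp
      · rw [if_neg (by omega), hq j hj, sub_zero]
    obtain ⟨a, ha⟩ := (ih _ hq').add (key.eval_mul (C (q.coeff k)))
    refine ⟨a, fun m => ?_⟩
    simp only [← ha, eval_C]
    rw [← borelSum_C_mul, ← map_add]
    congr 1
    ring

/-- The values of `borelSum y` on the powers of `P` satisfy a recurrence of order at most the
degree of `P`: the first `h + 1` shifts of this sequence lie in a module with `h` generators. -/
lemma exists_recurrence_borelSum_pow [IsDomain S] {P : S[X]} {h : ℕ} (hh : 0 < h)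
    (hdeg : P.natDegree ≤ h) {v : S} (hv : v * P.coeff h = 1) (hP0 : P.coeff 0 = 0) (y : S) :
    ∃ c : ℕ → S[X], (∃ i ≤ h, c i ≠ 0) ∧
      ∀ m : ℕ, ∑ i ∈ range (h + 1), (c i).eval (m : S) * borelSum y (P ^ (m + i)) = 0 := by
  have hred : ∀ i : ℕ, IsReducible P y h (fun m => borelSum y (P ^ i * P ^ m)) := fun i =>
    isReducible_borelSum hh hdeg hv hP0 y ((P ^ i).natDegree + 1) _
      (lt_of_le_of_lt degree_le_natDegree (by exact_mod_cast Nat.lt_succ_self _))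
  choose a ha using hred
  have hdep : ¬ LinearIndependent S[X] (fun i : Fin (h + 1) => a i) := by
    intro hli
    have := hli.fintype_card_le_finrank
    simp at this
  rw [Fintype.not_linearIndependent_iff] at hdep
  obtain ⟨g, hg, i₀, hi₀⟩ := hdep
  refine ⟨fun i => if hi : i < h + 1 then g ⟨i, hi⟩ else 0, ⟨i₀, by omega, by
    simpa [Nat.lt_succ_iff.1 i₀.2] using hi₀⟩,
    fun m => ?_⟩
  rw [← Fin.sum_univ_eq_sum_range
    (fun i => (if hi : i < h + 1 then g ⟨i, hi⟩ else 0).eval (m : S) * borelSum y (P ^ (m + i)))]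
  have hx : ∀ i : Fin (h + 1), borelSum y (P ^ (m + (i : ℕ))) =
      ∑ j, (a i j).eval (m : S) * borelSum y (X ^ (j : ℕ) * P ^ m) := fun i => by
    simp only [← ha, ← pow_add, add_comm]
  simp only [Fin.is_lt, dif_pos, Fin.eta, hx, Finset.mul_sum]
  rw [Finset.sum_comm]
  refine Finset.sum_eq_zero fun j _ => ?_
  have := congrArg (eval (m : S)) (congrFun hg j)
  simp only [Finset.sum_apply, Pi.smul_apply, smul_eq_mul, eval_finsetSum, Polynomial.eval_mul,
    Pi.zero_apply, eval_zero] at this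
  rw [← zero_mul (borelSum y (X ^ (j : ℕ) * P ^ m)), ← this, Finset.sum_mul]
  simp only [mul_assoc]

/-- If `n! F n` satisfies a recurrence on `ℕ` with polynomial coefficients, then so does the
extension of `F` by zero to `ℤ`. -/
lemma exists_recurrence_int_of_factorial_mul [IsDomain S] [CharZero S] {h : ℕ} {J : ℕ → S}
    {F : ℤ → S} (hF : ∀ n : ℕ, J n = n.factorial * F n) (hneg : ∀ n < 0, F n = 0)
    (hJ : ∃ c : ℕ → S[X], (∃ i ≤ h, c i ≠ 0) ∧
      ∀ m : ℕ, ∑ i ∈ range (h + 1), (c i).eval (m : S) * J (m + i) = 0) :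
    ∃ c : ℕ → S[X], (∃ i ≤ h, c i ≠ 0) ∧
      ∀ n : ℤ, ∑ i ∈ range (h + 1), (c i).eval (n : S) * F (n - i) = 0 := by
  obtain ⟨c, ⟨i₀, hi₀, hc⟩, hrec⟩ := hJ
  -- `∏ t < h, (X - t)` kills the arguments `0 ≤ n < h`; the factor `∏ i ≤ t < h, (X - t)` is
  -- `(n - i)! / (n - h)!`.
  refine ⟨fun i => (∏ t ∈ range h, (X - C (t : S))) *
    ((∏ t ∈ Ico i h, (X - C (t : S))) * (c (h - i)).comp (X - C (h : S))), ⟨h - i₀, by omega, ?_⟩,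
    fun n => ?_⟩
  · refine mul_ne_zero (Finset.prod_ne_zero_iff.2 fun _ _ => X_sub_C_ne_zero _)
      (mul_ne_zero (Finset.prod_ne_zero_iff.2 fun _ _ => X_sub_C_ne_zero _) ?_)
    rw [Nat.sub_sub_self hi₀]
    intro h0
    apply hc
    have := congrArg (fun f => f.comp (X + C (h : S))) h0
    simpa [comp_assoc] using this
  · rcases lt_or_ge n 0 with hn | hn
    · refine Finset.sum_eq_zero fun i _ => ?_
      rw [hneg _ (by omega), mul_zero]
    lift n to ℕ using hn
    rcases lt_or_ge n h with hn | hn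
    · refine Finset.sum_eq_zero fun i _ => ?_
      rw [eval_mul, eval_prod, Finset.prod_eq_zero (Finset.mem_range.2 hn) (by simp), zero_mul,
        zero_mul]
    obtain ⟨m, rfl⟩ := Nat.exists_eq_add_of_le' hn
    have hfac : ∀ d ≤ h, ((m + d).factorial : S) =
        m.factorial * ∏ t ∈ Ico (h - d) h, (((m + h : ℕ) : S) - t) := by
      intro d
      induction d with
      | zero => simp
      | succ d ih =>
        intro hd
        have e : h - d = (h - (d + 1)) + 1 := by omega
        rw [← add_assoc, Nat.factorial_succ, Finset.prod_eq_prod_Ico_succ_bot (by omega), ← e,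
          Nat.cast_mul, ih (by omega), Nat.cast_sub hd]
        push_cast
        ring
    have hm : (m.factorial : S) ≠ 0 := by exact_mod_cast m.factorial_ne_zero
    apply mul_left_cancel₀ hm
    rw [mul_zero, ← mul_zero (eval ((m + h : ℕ) : S) (∏ t ∈ range h, (X - C (t : S)))), ← hrec m,
      Finset.mul_sum, Finset.mul_sum, ← Finset.sum_range_reflect]
    refine Finset.sum_congr rfl fun i hi => ?_
    have hi' : i ≤ h := Nat.lt_succ_iff.1 (Finset.mem_range.1 hi)
    have e1 : h + 1 - 1 - i = h - i := by omega
    have e2 : (((m + h : ℕ) : ℤ) - ((h - i : ℕ) : ℤ)) = ((m + i : ℕ) : ℤ) := by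
      push_cast [Nat.cast_sub hi']; ring
    rw [e1, e2, hF, hfac i hi']
    simp only [Nat.sub_sub_self hi', eval_mul, eval_prod, eval_comp, eval_sub, eval_X, eval_C,
      Int.cast_natCast, Int.cast_add, Nat.cast_add, add_sub_cancel_right]
    ring

end Recurrence

/-! ### The generating function of the blocks -/

/-- The exponential series truncated after degree `s`. -/
noncomputable def expTrunc (s : ℕ) : ℚ[X] :=
  ∑ i ∈ range (s + 1), C ((i.factorial : ℚ)⁻¹) * X ^ i

lemma coeff_expTrunc (s k : ℕ) :
    (expTrunc s).coeff k = if k ≤ s then (k.factorial : ℚ)⁻¹ else 0 := by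
  simp [expTrunc, coeff_C_mul, coeff_X_pow]

lemma derivative_expTrunc_succ (s : ℕ) : derivative (expTrunc (s + 1)) = expTrunc s := by
  ext k
  rw [coeff_derivative, coeff_expTrunc, coeff_expTrunc]
  by_cases h : k ≤ s
  · rw [if_pos h, if_pos (by omega), Nat.factorial_succ]
    have := k.factorial_ne_zero
    push_cast
    field_simp
  · rw [if_neg h, if_neg (by omega), zero_mul]

lemma derivative_expTrunc_zero : derivative (expTrunc 0) = 0 := by
  simp [expTrunc]

/-- `∑ x ^ i / i!` over `1 ≤ i ≤ σ + 1`, the exponential generating function of the admissible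
blocks of a partition, and of the histories of a single gift. -/
noncomputable def blockPoly (σ : ℕ) : ℚ[X] := expTrunc (σ + 1) - 1

lemma derivative_blockPoly (σ : ℕ) : derivative (blockPoly σ) = expTrunc σ := by
  simp [blockPoly, derivative_expTrunc_succ]

lemma coeff_zero_expTrunc (s : ℕ) : (expTrunc s).coeff 0 = 1 := by
  simp [coeff_expTrunc]

lemma coeff_zero_blockPoly (σ : ℕ) : (blockPoly σ).coeff 0 = 0 := by
  simp [blockPoly, coeff_zero_expTrunc]

lemma coeff_blockPoly_top (σ : ℕ) :
    (blockPoly σ).coeff (σ + 1) = ((σ + 1).factorial : ℚ)⁻¹ := by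
  simp [blockPoly, coeff_expTrunc, coeff_one]

lemma natDegree_blockPoly_le (σ : ℕ) : (blockPoly σ).natDegree ≤ σ + 1 := by
  rw [natDegree_le_iff_coeff_eq_zero]
  intro k hk
  rw [blockPoly, coeff_sub, coeff_expTrunc, if_neg (by omega), coeff_one, if_neg (by omega),
    sub_zero]

lemma coeff_zero_blockPoly_pow (σ n : ℕ) :
    ((blockPoly σ) ^ n).coeff 0 = if n = 0 then 1 else 0 := by
  rw [coeff_zero_eq_eval_zero, eval_pow, ← coeff_zero_eq_eval_zero, coeff_zero_blockPoly,
    zero_pow_eq]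

lemma factorial_succ_mul_coeff_succ (f : ℚ[X]) (k : ℕ) :
    ((k + 1).factorial : ℚ) * f.coeff (k + 1) = k.factorial * (derivative f).coeff k := by
  rw [coeff_derivative, Nat.factorial_succ]
  push_cast
  ring

/-- If `n! F n` is the value of `borelSum y` on the `n`-th power of the block polynomial, then `F`
satisfies a recurrence. -/
lemma exists_recurrence_of_borelSum {S : Type*} [CommRing S] [IsDomain S] [CharZero S]
    [Algebra ℚ S] (σ : ℕ) (y : S) {F : ℤ → S} (hneg : ∀ n < 0, F n = 0)
    (hF : ∀ n : ℕ, borelSum y (((blockPoly σ) ^ n).map (algebraMap ℚ S)) = n.factorial * F n) :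
    ∃ c : ℕ → S[X], (∃ i ≤ σ + 1, c i ≠ 0) ∧
      ∀ n : ℤ, ∑ i ∈ range (σ + 1 + 1), (c i).eval (n : S) * F (n - i) = 0 := by
  refine exists_recurrence_int_of_factorial_mul hF hneg ?_
  simp only [Polynomial.map_pow]
  refine exists_recurrence_borelSum_pow (v := algebraMap ℚ S ((σ + 1).factorial : ℚ))
    (Nat.succ_pos σ) (natDegree_map_le.trans (natDegree_blockPoly_le σ)) ?_ ?_ y
  · rw [coeff_map, coeff_blockPoly_top, ← map_mul,
      mul_inv_cancel₀ (by exact_mod_cast (σ + 1).factorial_ne_zero), map_one]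
  · rw [coeff_map, coeff_zero_blockPoly, map_zero]

/-! ### Counting the plays of the game -/

/-- The position after the guest whose turn it is takes the gift `g`. -/
def Position.afterTake (p : Position) (g : ℕ) : Position :=
  if g = p.unwrapped + 1 then p.afterUnwrap else p.afterSteal g

/-- The gifts that may be taken in position `p`. -/
def Position.choices (σ : ℕ) (p : Position) : Finset ℕ :=
  insert (p.unwrapped + 1) {g ∈ Icc 1 p.unwrapped | p.thefts g < σ}

/-- The plays from `p` that consist of a given number of actions. -/
def plays (σ m : ℕ) : ℕ → Position → Finset (List (ℕ × ℕ))
  | 0, p => if p.unwrapped = m then {[]} else ∅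
  | k + 1, p => if p.unwrapped < m then
      (p.choices σ).biUnion fun g => (plays σ m k (p.afterTake g)).image (List.cons (p.turn, g))
    else ∅

lemma mem_plays (σ m : ℕ) (l : List (ℕ × ℕ)) :
    ∀ (k : ℕ) (p : Position), l ∈ plays σ m k p ↔ l.length = k ∧ IsPlay σ m p l := by
  induction l with
  | nil =>
    intro k p
    rcases k with _ | k
    · by_cases h : p.unwrapped = m <;> simp [plays, IsPlay, h]
    · by_cases h : p.unwrapped < m <;> simp [plays, h]
  | cons a l ih =>
    obtain ⟨x, g⟩ := a
    intro k p
    rcases k with _ | k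
    · by_cases h : p.unwrapped = m <;> simp [plays, h]
    · by_cases h : p.unwrapped < m
      · simp only [plays, h, if_true, mem_biUnion, mem_image, List.cons.injEq, Prod.mk.injEq,
          IsPlay, true_and, List.length_cons, Nat.add_right_cancel_iff, Position.choices,
          mem_insert, mem_filter, mem_Icc]
        constructor
        · rintro ⟨g', hg', l', hl', ⟨rfl, rfl⟩, rfl⟩
          rw [ih] at hl'
          refine ⟨hl'.1, rfl, ?_⟩
          rcases hg' with rfl | hg'
          · left
            simpa [Position.afterTake] using hl'.2
          · right
            have hne : g' ≠ p.unwrapped + 1 := by omega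
            refine ⟨hg'.1, hg'.2, ?_⟩
            simpa [Position.afterTake, hne] using hl'.2
        · rintro ⟨hl, rfl, ⟨rfl, hp⟩ | ⟨hg, ht, hp⟩⟩
          · exact ⟨_, Or.inl rfl, l, (ih _ _).2 ⟨hl, by simpa [Position.afterTake] using hp⟩,
              ⟨rfl, rfl⟩, rfl⟩
          · have hne : g ≠ p.unwrapped + 1 := by omega
            exact ⟨_, Or.inr ⟨hg, ht⟩, l,
              (ih _ _).2 ⟨hl, by simpa [Position.afterTake, hne] using hp⟩, ⟨rfl, rfl⟩, rfl⟩
      · simp [plays, h, IsPlay]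

lemma card_plays_zero {σ m : ℕ} {p : Position} (h : p.unwrapped < m) :
    (plays σ m 0 p).card = 0 := by
  simp [plays, h.ne]

lemma card_plays_succ {σ m : ℕ} {p : Position} (h : p.unwrapped < m) (k : ℕ) :
    (plays σ m (k + 1) p).card = (plays σ m k p.afterUnwrap).card +
      ∑ g ∈ Icc 1 p.unwrapped with p.thefts g < σ, (plays σ m k (p.afterSteal g)).card := by
  have hcard : ∀ g, ((plays σ m k (p.afterTake g)).image (List.cons (p.turn, g))).card =
      (plays σ m k (p.afterTake g)).card := fun g =>
    card_image_of_injective _ (List.cons_injective)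
  rw [plays, if_pos h, card_biUnion, Position.choices, Finset.sum_insert (by simp)]
  · simp only [hcard]
    congr 1
    · simp [Position.afterTake]
    · refine Finset.sum_congr rfl fun g hg => ?_
      have hne : g ≠ p.unwrapped + 1 := by
        rw [mem_filter, mem_Icc] at hg
        omega
      simp [Position.afterTake, hne]
  · intro g _ g' _ hne
    rw [Function.onFun, Finset.disjoint_left]
    intro l hl hl'
    rw [mem_image] at hl hl'
    obtain ⟨_, _, rfl⟩ := hl
    obtain ⟨_, _, h'⟩ := hl'
    simp only [List.cons.injEq, Prod.mk.injEq] at h'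
    exact hne h'.1.2.symm

/-- The exponential generating function of the ways in which the unwrapped gifts can still be
stolen: a gift that may be stolen `s` more times contributes the factor `expTrunc s`. -/
noncomputable def Position.stealPoly (σ : ℕ) (p : Position) : ℚ[X] :=
  ∏ g ∈ Icc 1 p.unwrapped, expTrunc (σ - p.thefts g)

lemma Position.stealPoly_afterUnwrap (σ : ℕ) {p : Position}
    (hp : p.thefts (p.unwrapped + 1) = 0) :
    p.afterUnwrap.stealPoly σ = p.stealPoly σ * expTrunc σ := by
  simp only [Position.stealPoly, Position.afterUnwrap]
  rw [Finset.prod_Icc_succ_top (by omega), hp, Nat.sub_zero]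

lemma Position.derivative_stealPoly (σ : ℕ) (p : Position) :
    derivative (p.stealPoly σ) =
      ∑ g ∈ Icc 1 p.unwrapped with p.thefts g < σ, (p.afterSteal g).stealPoly σ := by
  rw [Position.stealPoly, derivative_prod_finset, Finset.sum_filter]
  refine Finset.sum_congr rfl fun g hg => ?_
  split_ifs with h
  · obtain ⟨s, hs⟩ : ∃ s, σ - p.thefts g = s + 1 := ⟨σ - p.thefts g - 1, by omega⟩
    simp only [Position.stealPoly, Position.afterSteal]
    rw [hs, derivative_expTrunc_succ, ← Finset.prod_erase_mul _ _ hg, Function.update_self,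
      (by omega : σ - (p.thefts g + 1) = s)]
    congr 1
    refine Finset.prod_congr rfl fun g' hg' => ?_
    rw [Function.update_of_ne (Finset.ne_of_mem_erase hg')]
  · rw [(by omega : σ - p.thefts g = 0), derivative_expTrunc_zero, mul_zero]

/-- The number of plays of given length, as a coefficient of a generating function: differentiating
the generating function amounts to making one move. The last action, which takes the gift `m`, is
not recorded by the generating function; hence `k + 1` actions, but the coefficient of `x ^ k`. -/
lemma factorial_mul_card_plays (σ m k : ℕ) : ∀ (b : ℕ) (p : Position),
    p.unwrapped + b + 1 = m → (∀ g, p.unwrapped < g → p.thefts g = 0) →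
    (b.factorial : ℚ) * (plays σ m (k + 1) p).card =
      k.factorial * (p.stealPoly σ * blockPoly σ ^ b).coeff k := by
  induction k with
  | zero =>
    intro b p hb hp
    rw [card_plays_succ (by omega), Finset.sum_eq_zero, mul_coeff_zero, coeff_zero_blockPoly_pow]
    · have h1 : (p.stealPoly σ).coeff 0 = 1 := by
        rw [coeff_zero_eq_eval_zero, Position.stealPoly, eval_prod]
        exact Finset.prod_eq_one fun g _ => by
          rw [← coeff_zero_eq_eval_zero, coeff_zero_expTrunc]
      rw [h1]
      rcases b with _ | b
      · have : p.unwrapped + 1 = m := by omega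
        simp [plays, Position.afterUnwrap, this]
      · have : p.unwrapped + 1 ≠ m := by omega
        simp [plays, Position.afterUnwrap, this]
    · intro g _
      exact card_plays_zero (by simp only [Position.afterSteal]; omega)
  | succ k ih =>
    intro b p hb hp
    have hsteal : ∀ g ∈ (Icc 1 p.unwrapped).filter (fun g => p.thefts g < σ),
        (b.factorial : ℚ) * (plays σ m (k + 1) (p.afterSteal g)).card =
          k.factorial * ((p.afterSteal g).stealPoly σ * blockPoly σ ^ b).coeff k := by
      intro g hg
      refine ih b _ hb fun g' hg' => ?_
      simp only [Position.afterSteal] at hg' ⊢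
      rw [mem_filter, mem_Icc] at hg
      rw [Function.update_of_ne (by omega), hp g' hg']
    have hunwrap : (b.factorial : ℚ) * (plays σ m (k + 1) p.afterUnwrap).card =
        k.factorial * (p.stealPoly σ * derivative (blockPoly σ ^ b)).coeff k := by
      rcases b with _ | b
      · have : ¬ p.unwrapped + 1 < m := by omega
        simp [plays, Position.afterUnwrap, this]
      · have := ih b p.afterUnwrap (by simp only [Position.afterUnwrap]; omega)
          (fun g hg => hp g (by simp only [Position.afterUnwrap] at hg; omega))
        rw [Position.stealPoly_afterUnwrap σ (hp _ (Nat.lt_succ_self _))] at this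
        rw [Nat.factorial_succ, Nat.cast_mul, mul_assoc, this, derivative_pow_succ,
          derivative_blockPoly]
        rw [show p.stealPoly σ * (C (b + 1 : ℚ) * blockPoly σ ^ b * expTrunc σ) =
          C (b + 1 : ℚ) * (p.stealPoly σ * expTrunc σ * blockPoly σ ^ b) by ring, coeff_C_mul]
        push_cast
        ring
    rw [card_plays_succ (by omega), Nat.cast_add, mul_add, hunwrap, Nat.cast_sum, Finset.mul_sum,
      Finset.sum_congr rfl hsteal, factorial_succ_mul_coeff_succ, derivative_mul,
      Position.derivative_stealPoly, coeff_add, Finset.sum_mul, finsetSum_coeff, mul_add,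
      Finset.mul_sum, add_comm]

lemma factorial_mul_G (σ n : ℕ) :
    borelSum (1 : ℚ) (blockPoly σ ^ n) = n.factorial * (G σ n : ℚ) := by
  set D := (blockPoly σ ^ n).natDegree with hD
  have hcard : ∀ k, (n.factorial : ℚ) * (plays σ (n + 1) (k + 1) Position.start).card =
      k.factorial * (blockPoly σ ^ n).coeff k := by
    intro k
    have := factorial_mul_card_plays σ (n + 1) k n Position.start
      (by simp [Position.start]) (fun _ _ => rfl)
    simpa [Position.stealPoly, Position.start] using this
  have hset : {l : List (ℕ × ℕ) | IsPlay σ (n + 1) Position.start l} =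
      ((range (D + 1)).biUnion fun k => plays σ (n + 1) (k + 1) Position.start : Finset _) := by
    ext l
    simp only [Set.mem_ofPred_eq, coe_biUnion, Set.mem_iUnion, mem_coe, mem_range, mem_plays,
      exists_prop]
    refine ⟨fun hl => ?_, fun ⟨_, _, _, hl⟩ => hl⟩
    obtain ⟨k, hk⟩ : ∃ k, l.length = k + 1 := by
      rcases l with _ | ⟨a, l⟩
      · simp [IsPlay, Position.start] at hl
      · exact ⟨l.length, rfl⟩
    refine ⟨k, ?_, hk, hl⟩
    by_contra hlt
    have h0 := hcard k
    rw [coeff_eq_zero_of_natDegree_lt (by omega), mul_zero, mul_eq_zero] at h0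
    rcases h0 with h0 | h0
    · exact n.factorial_ne_zero (by exact_mod_cast h0)
    · have : plays σ (n + 1) (k + 1) Position.start = ∅ := by
        rw [← Finset.card_eq_zero]
        exact_mod_cast h0
      have hmem := (mem_plays σ (n + 1) l (k + 1) Position.start).2 ⟨hk, hl⟩
      simp [this] at hmem
  have hG : G σ n = ∑ k ∈ range (D + 1), (plays σ (n + 1) (k + 1) Position.start).card := by
    rw [G, if_pos (by omega), Int.toNat_natCast, hset, Set.ncard_coe_finset, card_biUnion]
    intro i _ j _ hij
    rw [Function.onFun, Finset.disjoint_left]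
    intro l hl hl'
    rw [mem_plays] at hl hl'
    omega
  rw [hG, borelSum_apply, sum_over_range _ (by simp), Nat.cast_sum, Finset.mul_sum]
  refine Finset.sum_congr rfl fun k _ => ?_
  rw [hcard, one_pow, mul_one]

/-! ### Counting partitions with blocks of bounded size -/

section Partitions

variable {α : Type*} [DecidableEq α]

/-- The partitions of `s` into `n` blocks of size at most `h`. -/
def boundedPartitions (h : ℕ) (s : Finset α) (n : ℕ) : Finset (Finpartition s) :=
  {P | P.parts.card = n ∧ ∀ b ∈ P.parts, b.card ≤ h}

lemma mem_boundedPartitions {h n : ℕ} {s : Finset α} {P : Finpartition s} :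
    P ∈ boundedPartitions h s n ↔ P.parts.card = n ∧ ∀ b ∈ P.parts, b.card ≤ h := by
  simp [boundedPartitions]

lemma card_boundedPartitions_zero (h : ℕ) (s : Finset α) :
    (boundedPartitions h s 0).card = if s.card = 0 then 1 else 0 := by
  split_ifs with hs
  · rw [Finset.card_eq_zero] at hs
    subst hs
    have : boundedPartitions h (∅ : Finset α) 0 = univ := by
      ext P
      have : P.parts = ∅ := Finpartition.parts_eq_empty_iff.2 rfl
      simp [mem_boundedPartitions, this]
    rw [this]
    exact Fintype.card_unique (α := Finpartition (⊥ : Finset α))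
  · rw [Finset.card_eq_zero, Finset.eq_empty_iff_forall_notMem]
    intro P hP
    rw [mem_boundedPartitions, Finset.card_eq_zero, Finpartition.parts_eq_empty_iff] at hP
    simp [hP.1] at hs

lemma boundedPartitions_empty_succ (h n : ℕ) :
    boundedPartitions h (∅ : Finset α) (n + 1) = ∅ := by
  rw [Finset.eq_empty_iff_forall_notMem]
  intro P hP
  have : P.parts = ∅ := Finpartition.parts_eq_empty_iff.2 rfl
  simp [mem_boundedPartitions, this] at hP

/-- Adding the block `insert a u` identifies the partitions of `t \ u` with the partitions of
`insert a t` that have this block. -/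
lemma card_boundedPartitions_part_eq {h n : ℕ} {a : α} {t u : Finset α} (ha : a ∉ t)
    (hu : u ⊆ t) (huh : u.card + 1 ≤ h) :
    (boundedPartitions h (t \ u) n).card =
      {P ∈ boundedPartitions h (insert a t) (n + 1) | (P.part a).erase a = u}.card := by
  have hau : a ∉ u := fun h => ha (hu h)
  have hne : insert a u ≠ (⊥ : Finset α) := Finset.insert_ne_empty _ _
  have hdis : Disjoint (t \ u) (insert a u) := by
    rw [Finset.disjoint_left]
    intro x hx hx'
    rw [mem_sdiff] at hx
    rcases Finset.mem_insert.1 hx' with rfl | hx'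
    · exact ha hx.1
    · exact hx.2 hx'
  have hsup : t \ u ⊔ insert a u = insert a t := by
    rw [Finset.sup_eq_union, Finset.union_insert, Finset.sdiff_union_of_subset hu]
  have hnot : ∀ Q : Finpartition (t \ u), insert a u ∉ Q.parts := fun Q hQ =>
    ha (mem_sdiff.1 (Q.le hQ (mem_insert_self a u))).1
  refine Finset.card_bij (fun Q _ => Q.extend hne hdis hsup) ?_ ?_ ?_
  · intro Q hQ
    rw [mem_boundedPartitions] at hQ
    rw [mem_filter, mem_boundedPartitions]
    refine ⟨⟨?_, ?_⟩, ?_⟩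
    · rw [Finpartition.card_extend, hQ.1]
    · intro b hb
      rw [Finpartition.extend_parts, mem_insert] at hb
      rcases hb with rfl | hb
      · rwa [card_insert_of_notMem hau]
      · exact hQ.2 b hb
    · rw [Finpartition.part_eq_of_mem _ (t := insert a u) (by simp) (mem_insert_self a u),
        erase_insert hau]
  · intro Q _ Q' _ heq
    have := congrArg (fun P : Finpartition (insert a t) => P.parts.erase (insert a u)) heq
    simp only [Finpartition.extend_parts, erase_insert (hnot _)] at this
    exact Finpartition.ext this
  · intro P hP
    rw [mem_filter, mem_boundedPartitions] at hP
    obtain ⟨⟨hPn, hPh⟩, hPu⟩ := hP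
    have hpart : P.part a = insert a u := by
      rw [← hPu, insert_erase (P.mem_part (mem_insert_self a t))]
    have hmem : insert a u ∈ P.parts := by
      rw [← hpart]
      exact P.part_mem.2 (mem_insert_self a t)
    let Q : Finpartition (t \ u) :=
      { parts := P.parts.erase (insert a u)
        supIndep := P.supIndep.subset (erase_subset _ _)
        sup_parts := by
          ext x
          simp only [mem_sup, mem_erase, id_eq, mem_sdiff]
          constructor
          · rintro ⟨b, ⟨hb, hbP⟩, hx⟩
            have hx' : x ∉ insert a u := fun hx' => hb (P.eq_of_mem_parts hbP hmem hx hx')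
            rw [mem_insert, not_or] at hx'
            exact ⟨(mem_insert.1 (P.le hbP hx)).resolve_left hx'.1, hx'.2⟩
          · rintro ⟨hxt, hxu⟩
            obtain ⟨b, hb, hx⟩ := P.exists_mem (mem_insert_of_mem (b := a) hxt)
            refine ⟨b, ⟨?_, hb⟩, hx⟩
            rintro rfl
            rcases mem_insert.1 hx with rfl | hx
            · exact ha hxt
            · exact hxu hx
        bot_notMem := fun hb => P.bot_notMem (mem_of_mem_erase hb) }
    refine ⟨Q, ?_, ?_⟩
    · rw [mem_boundedPartitions]
      refine ⟨?_, fun b hb => hPh b (mem_of_mem_erase hb)⟩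
      change (P.parts.erase (insert a u)).card = n
      rw [card_erase_of_mem hmem, hPn, Nat.add_sub_cancel]
    · apply Finpartition.ext
      rw [Finpartition.extend_parts]
      exact insert_erase hmem

/-- Classify the partitions of `insert a t` by the block of `a`. -/
lemma card_boundedPartitions_insert (h n : ℕ) {a : α} {t : Finset α} (ha : a ∉ t) :
    (boundedPartitions h (insert a t) (n + 1)).card =
      ∑ u ∈ t.powerset, if u.card + 1 ≤ h then (boundedPartitions h (t \ u) n).card else 0 := by
  rw [← Finset.sum_filter,
    Finset.card_eq_sum_card_fiberwise (f := fun P => (P.part a).erase a)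
      (t := t.powerset.filter fun u => u.card + 1 ≤ h)]
  · refine Finset.sum_congr rfl fun u hu => ?_
    rw [mem_filter, mem_powerset] at hu
    exact (card_boundedPartitions_part_eq ha hu.1 hu.2).symm
  · intro P hP
    have hP' := (mem_boundedPartitions.1 (mem_coe.1 hP)).2 (P.part a)
      (P.part_mem.2 (mem_insert_self a t))
    have hmem := P.mem_part (mem_insert_self a t)
    rw [mem_coe, mem_filter, mem_powerset, card_erase_add_one hmem]
    refine ⟨?_, hP'⟩
    exact (erase_subset_erase a (P.part_subset a)).trans (erase_insert ha).subset

lemma factorial_mul_card_boundedPartitions (σ n : ℕ) : ∀ s : Finset α,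
    (n.factorial : ℚ) * (boundedPartitions (σ + 1) s n).card =
      s.card.factorial * (blockPoly σ ^ n).coeff s.card := by
  induction n with
  | zero =>
    intro s
    rw [card_boundedPartitions_zero, pow_zero, coeff_one]
    by_cases hs : s.card = 0 <;> simp [hs]
  | succ n ih =>
    intro s
    induction s using Finset.induction_on with
    | empty => simp [boundedPartitions_empty_succ, coeff_zero_blockPoly_pow]
    | insert a t ha _ =>
      let f : ℕ → ℚ := fun j =>
        if j ≤ σ then (t.card - j).factorial * (blockPoly σ ^ n).coeff (t.card - j) else 0
      have hterm : ∀ u ∈ t.powerset, (n.factorial : ℚ) *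
          ((if u.card + 1 ≤ σ + 1 then (boundedPartitions (σ + 1) (t \ u) n).card else 0 : ℕ) : ℚ) =
          f u.card := by
        intro u hu
        simp only [Nat.add_le_add_iff_right, f]
        split_ifs
        · rw [ih, card_sdiff_of_subset (mem_powerset.1 hu)]
        · simp
      rw [card_boundedPartitions_insert _ _ ha, card_insert_of_notMem ha,
        factorial_succ_mul_coeff_succ, derivative_pow_succ, derivative_blockPoly, mul_assoc,
        coeff_C_mul, Nat.factorial_succ, Nat.cast_mul, mul_assoc, Nat.cast_sum, Finset.mul_sum,
        Finset.sum_congr rfl hterm, Finset.sum_powerset_apply_card f,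
        mul_comm (_ ^ n), coeff_mul, Finset.Nat.sum_antidiagonal_eq_sum_range_succ_mk,
        Finset.mul_sum, Finset.mul_sum, Finset.mul_sum]
      push_cast
      refine Finset.sum_congr rfl fun j hj => ?_
      have hj' : j ≤ t.card := Nat.lt_succ_iff.1 (mem_range.1 hj)
      simp only [f]
      rw [coeff_expTrunc, nsmul_eq_mul, Nat.cast_choose ℚ hj']
      have h1 : (j.factorial : ℚ) ≠ 0 := by exact_mod_cast j.factorial_ne_zero
      have h2 : ((t.card - j).factorial : ℚ) ≠ 0 := by
        exact_mod_cast (t.card - j).factorial_ne_zero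
      split_ifs
      · field_simp
      · simp

end Partitions

lemma factorial_mul_E (σ n k : ℕ) :
    (n.factorial : ℚ) * E σ n k = k.factorial * (blockPoly σ ^ n).coeff k := by
  have h := factorial_mul_card_boundedPartitions σ n (univ : Finset (Fin k))
  rw [card_univ, Fintype.card_fin] at h
  rw [← h, E, if_pos (by omega), Int.toNat_natCast, Int.toNat_natCast, restrictedStirling,
    ← Set.ncard_coe_finset]
  congr 3
  ext P
  simp [mem_boundedPartitions]

/-! ### The recurrences -/

lemma coeff_borelSum_X (f : ℚ[X]) (k : ℕ) :
    (borelSum (X : ℚ[X]) (f.map (algebraMap ℚ ℚ[X]))).coeff k = k.factorial * f.coeff k := by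
  induction f using Polynomial.induction_on' with
  | add p q hp hq => simp only [Polynomial.map_add, map_add, coeff_add, hp, hq, mul_add]
  | monomial j a =>
    rw [map_monomial, borelSum_monomial, ← C_eq_algebraMap, mul_comm, ← mul_assoc,
      ← map_natCast (C : ℚ →+* ℚ[X]), ← C_mul, coeff_C_mul_X_pow, coeff_monomial]
    by_cases h : k = j
    · rw [if_pos h, if_pos h.symm, h, mul_comm]
    · rw [if_neg h, if_neg (Ne.symm h), mul_zero]

/-- The generating polynomial `∑ k, E σ n k X ^ k` of a row of the triangle `E σ`. -/
noncomputable def rowPoly (σ : ℕ) (n : ℤ) : ℚ[X] :=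
  if 0 ≤ n then C ((n.toNat.factorial : ℚ)⁻¹) *
    borelSum (X : ℚ[X]) ((blockPoly σ ^ n.toNat).map (algebraMap ℚ ℚ[X])) else 0

lemma coeff_rowPoly (σ : ℕ) (n : ℤ) (k : ℕ) : (rowPoly σ n).coeff k = E σ n k := by
  rw [rowPoly]
  split_ifs with hn
  · lift n to ℕ using hn
    have := factorial_mul_E σ n k
    have h0 : (n.factorial : ℚ) ≠ 0 := by exact_mod_cast n.factorial_ne_zero
    rw [Int.toNat_natCast, coeff_C_mul, coeff_borelSum_X, ← this, inv_mul_cancel_left₀ h0]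
  · rw [E, if_neg (by omega), coeff_zero, Nat.cast_zero]

lemma E_of_neg_right (σ : ℕ) (n : ℤ) {k : ℤ} (hk : k < 0) : E σ n k = 0 := by
  rw [E, if_neg (by omega)]

lemma coeff_mul_rowPoly (σ : ℕ) (n : ℤ) {δ : ℕ} {f : ℚ[X]} (hf : ∀ j, δ < j → f.coeff j = 0)
    (k : ℕ) : (f * rowPoly σ n).coeff k =
      ∑ j ∈ range (δ + 1), f.coeff j * (E σ n ((k : ℤ) - j) : ℚ) := by
  have hsub : ∀ j ∈ range (k + 1), f.coeff j * (rowPoly σ n).coeff (k - j) =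
      f.coeff j * (E σ n ((k : ℤ) - j) : ℚ) := fun j hj => by
    rw [coeff_rowPoly, Nat.cast_sub (Nat.lt_succ_iff.1 (mem_range.1 hj))]
  rw [coeff_mul, Finset.Nat.sum_antidiagonal_eq_sum_range_succ_mk, Finset.sum_congr rfl hsub,
    Finset.sum_subset (Finset.range_mono (show k + 1 ≤ k + 1 + δ by omega)),
    ← Finset.sum_subset (Finset.range_mono (show δ + 1 ≤ k + 1 + δ by omega))]
  · intro j _ hj
    rw [hf j (by rw [mem_range] at hj; omega), zero_mul]
  · intro j _ hj
    rw [E_of_neg_right _ _ (by rw [mem_range] at hj; omega), Nat.cast_zero, mul_zero]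

/-- Coefficients of the value of a bivariate polynomial at a constant of the outer variable. -/
lemma coeff_eval_C (f : ℚ[X][X]) (x : ℚ) (j : ℕ) :
    (f.eval (C x)).coeff j = ((Bivariate.swap f).coeff j).eval x := by
  induction f using Polynomial.induction_on' with
  | add p q hp hq => simp only [eval_add, coeff_add, map_add, hp, hq]
  | monomial t f =>
    rw [Bivariate.swap_monomial, coeff_mul_C, coeff_map, eval_monomial, ← C_pow, coeff_mul_C]
    simp

lemma exists_recurrence_E (σ : ℕ) :
    ∃ (δ : ℕ) (C : ℕ → ℕ → ℚ[X]), (∃ i ≤ δ, ∃ j ≤ δ, C i j ≠ 0) ∧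
      ∀ n k : ℤ, ∑ i ∈ Finset.range (δ + 1), ∑ j ∈ Finset.range (δ + 1),
        (C i j).eval (n : ℚ) * (E σ (n - (i : ℤ)) (k - (j : ℤ)) : ℚ) = 0 := by
  obtain ⟨c, ⟨i₀, hi₀, hc⟩, hrec⟩ := exists_recurrence_of_borelSum σ (X : ℚ[X])
    (F := rowPoly σ) (fun n hn => by rw [rowPoly, if_neg (by omega)]) (fun n => by
      have h0 : (n.factorial : ℚ) ≠ 0 := by exact_mod_cast n.factorial_ne_zero
      rw [rowPoly, if_pos (by omega), Int.toNat_natCast, ← map_natCast (C : ℚ →+* ℚ[X]),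
        ← mul_assoc, ← C_mul, mul_inv_cancel₀ h0, C_1, one_mul])
  -- `(swap (c i)).coeff j` collects the coefficient of `y ^ j` in `c i` as a polynomial in `n`.
  have hcoeff : ∀ (i : ℕ) (n : ℤ) (j : ℕ),
      ((c i).eval (n : ℚ[X])).coeff j = ((Bivariate.swap (c i)).coeff j).eval (n : ℚ) := by
    intro i n j
    rw [← map_intCast (C : ℚ →+* ℚ[X]), coeff_eval_C]
  set N := (range (σ + 1 + 1)).sup fun i => (Bivariate.swap (c i)).natDegree with hN
  have hdeg : ∀ i ∈ range (σ + 1 + 1), ∀ j, max (σ + 1) N < j →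
      (Bivariate.swap (c i)).coeff j = 0 := fun i hi j hj =>
    coeff_eq_zero_of_natDegree_lt (lt_of_le_of_lt
      ((Finset.le_sup (f := fun i => (Bivariate.swap (c i)).natDegree) hi).trans
        (le_max_right _ _)) hj)
  refine ⟨max (σ + 1) N, fun i j => if i ≤ σ + 1 then (Bivariate.swap (c i)).coeff j else 0,
    ⟨i₀, hi₀.trans (le_max_left _ _), ?_⟩, fun n k => ?_⟩
  · have hne : Bivariate.swap (c i₀) ≠ 0 := by simpa using hc
    refine ⟨(Bivariate.swap (c i₀)).natDegree, ?_, ?_⟩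
    · by_contra hlt
      exact hne (leadingCoeff_eq_zero.1
        (hdeg i₀ (mem_range.2 (by omega)) _ (not_le.1 hlt)))
    · simp only [if_pos hi₀]
      exact leadingCoeff_ne_zero.2 hne
  · rw [← Finset.sum_subset (Finset.range_mono (Nat.succ_le_succ (le_max_left (σ + 1) N)))]
    · rcases lt_or_ge k 0 with hk | hk
      · refine Finset.sum_eq_zero fun i _ => Finset.sum_eq_zero fun j _ => ?_
        rw [E_of_neg_right _ _ (by omega), Nat.cast_zero, mul_zero]
      lift k to ℕ using hk
      have hk := congrArg (fun f => f.coeff k) (hrec n)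
      simp only [finsetSum_coeff, coeff_zero] at hk
      rw [← hk]
      refine Finset.sum_congr rfl fun i hi => ?_
      rw [coeff_mul_rowPoly σ _ (fun j hj => by rw [hcoeff, hdeg i hi j hj, eval_zero])]
      refine Finset.sum_congr rfl fun j _ => ?_
      simp only [hcoeff, if_pos (Nat.lt_succ_iff.1 (mem_range.1 hi))]
    · intro i _ hi
      refine Finset.sum_eq_zero fun j _ => ?_
      simp only [if_neg (fun h => hi (mem_range.2 (Nat.lt_succ_iff.2 h))), eval_zero, zero_mul]

lemma exists_recurrence_G (σ : ℕ) :
    ∃ (δ : ℕ) (C : ℕ → ℚ[X]), (∃ i ≤ δ, C i ≠ 0) ∧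
      ∀ n : ℤ, ∑ i ∈ Finset.range (δ + 1),
        (C i).eval (n : ℚ) * (G σ (n - (i : ℤ)) : ℚ) = 0 := by
  obtain ⟨c, hc, hrec⟩ := exists_recurrence_of_borelSum σ (1 : ℚ)
    (F := fun n => (G σ n : ℚ)) (fun n hn => by rw [G, if_neg (by omega), Nat.cast_zero])
    (fun n => by rw [Algebra.algebraMap_self, Polynomial.map_id, factorial_mul_G])
  exact ⟨σ + 1, c, hc, hrec⟩

end GiftSwap

theorem theorem7 (σ : ℕ) (hσ : 1 ≤ σ) :
    (∃ (δ : ℕ) (C : ℕ → ℕ → ℚ[X]),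
      (∃ i ≤ δ, ∃ j ≤ δ, C i j ≠ 0) ∧
      ∀ n k : ℤ,
        ∑ i ∈ Finset.range (δ + 1), ∑ j ∈ Finset.range (δ + 1),
          (C i j).eval (n : ℚ) * (GiftSwap.E σ (n - (i : ℤ)) (k - (j : ℤ)) : ℚ) = 0) ∧
    (∃ (δ : ℕ) (C : ℕ → ℚ[X]),
      (∃ i ≤ δ, C i ≠ 0) ∧
      ∀ n : ℤ,
        ∑ i ∈ Finset.range (δ + 1),
          (C i).eval (n : ℚ) * (GiftSwap.G σ (n - (i : ℤ)) : ℚ) = 0) :=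
  ⟨GiftSwap.exists_recurrence_E σ, GiftSwap.exists_recurrence_G σ⟩
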